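/- All graphs are finite and simple. A collection $(G_1,\dots,G_t)$ of graphs on a common vertex set contains a rainbow copy of a graph $H$ if there is a (not necessarily induced) copy of $H$ on that vertex set to whose edges one can assign pairwise distinct indices so that an edge with index $i$ belongs to $E(G_i)$. The collection is rainbow $\mathcal F$-free if it contains no rainbow copy of any member of the family $\mathcal F$. Let $\mathrm{ex}_t^{\Sigma}(n,\mathcal F)$ be the largest value of $\sum_{i=1}^t|E(G_i)|$ over all rainbow $\mathcal F$-free collections $(G_1,\dots,G_t)$ on $n$ vertices (and $0$ if there is no such collection), write $\mathrm{ex}_t^{\Sigma}(n,F)$ for $\mathrm{ex}_t^{\Sigma}(n,\{F\})$, and let $M_r$ be the matching with $r$ edges. **Theorem 2.** Let $F$ be a graph, and let $s\ge 0$ and $t$ be integers. (i) If $t\ge\max\{|E(F)|,s+1\}$, then, as $n\to\infty$ with $F,s,t$ fixed, $$\mathrm{ex}_t^{\Sigma}(n,\{F,M_{s+1}\})=\mathrm{ex}_s^{\Sigma}(n,F)+O(n).$$ (ii) If $t\ge\max\{3,s+1\}$, then for all sufficiently large $n$ (depending on $s$ and $t$) $$\mathrm{ex}_t^{\Sigma}(n,\{K_3,M_{s+1}\})=\mathrm{ex}_s^{\Sigma}(n,K_3),$$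 and, for such $n$, $\mathrm{ex}_s^{\Sigma}(n,K_3)$ equals $s\binom n2$ if $s\le 2$, $n(n-1)$ if $s=3$, and $s\lfloor n^2/4\rfloor$ if $s\ge 4$. -/

import Mathlib

open Filter Asymptotics

/-- A family of finite graphs; every finite graph is represented, up to isomorphism,
on some vertex set `Fin k`. -/
abbrev GraphFamily := Set (Σ k : ℕ, SimpleGraph (Fin k))

/-- The collection `G` contains a rainbow copy of `F`: there is an injection of the vertices of `F`
and a choice of pairwise distinct indices, one for each edge of `F`, such that
the image of the edge lies in the graph with the chosen index. -/
def HasRainbowCopy {k n t : ℕ} (F : SimpleGraph (Fin k)) (G : Fin t → SimpleGraph (Fin n)) : Prop :=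
  ∃ (φ : Fin k ↪ Fin n) (c : F.edgeSet → Fin t), Function.Injective c ∧
    ∀ e : F.edgeSet, Sym2.map φ (e : Sym2 (Fin k)) ∈ (G (c e)).edgeSet

/-- The collection `G` contains no rainbow copy of any member of the family. -/
def RainbowFree {n t : ℕ} (𝓕 : GraphFamily) (G : Fin t → SimpleGraph (Fin n)) : Prop :=
  ∀ F ∈ 𝓕, ¬ HasRainbowCopy F.2 G

/-- The total number of edges of a collection, counted with multiplicity. -/
noncomputable def edgeSum {n t : ℕ} (G : Fin t → SimpleGraph (Fin n)) : ℕ :=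
  ∑ i, (G i).edgeSet.ncard

/-- The possible total numbers of edges of rainbow `𝓕`-free collections of `t` graphs
on `n` vertices. -/
def edgeSums (t n : ℕ) (𝓕 : GraphFamily) : Set ℕ :=
  {m | ∃ G : Fin t → SimpleGraph (Fin n), RainbowFree 𝓕 G ∧ edgeSum G = m}

/-- The largest total number of edges of a rainbow `𝓕`-free collection of `t` graphs on
`n` vertices (and `0` if there is no such collection, which can only happen if some member
of `𝓕` has no edge). -/
noncomputable def exSum (t n : ℕ) (𝓕 : GraphFamily) : ℕ := sSup (edgeSums t n 𝓕)

theorem edgeSums_finite (t n : ℕ) (𝓕 : GraphFamily) : (edgeSums t n 𝓕).Finite :=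
  (Set.finite_range (edgeSum (n := n) (t := t))).subset (by
    rintro m ⟨G, -, rfl⟩
    exact ⟨G, rfl⟩)

/-- The supremum is a maximum as soon as there is a rainbow `𝓕`-free collection. -/
theorem isGreatest_exSum {t n : ℕ} {𝓕 : GraphFamily} (h : (edgeSums t n 𝓕).Nonempty) :
    IsGreatest (edgeSums t n 𝓕) (exSum t n 𝓕) :=
  ⟨Nat.sSup_mem h (edgeSums_finite t n 𝓕).bddAbove,
    fun _ hm => le_csSup (edgeSums_finite t n 𝓕).bddAbove hm⟩

/-- The matching `M_r` with `r` edges `{0,1}, {2,3}, …, {2r-2, 2r-1}`. -/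
def matchingGraph (r : ℕ) : SimpleGraph (Fin (2 * r)) where
  Adj i j := i ≠ j ∧ i.val / 2 = j.val / 2
  symm := ⟨fun _ _ h => ⟨h.1.symm, h.2.symm⟩⟩
  loopless := ⟨fun _ h => h.1 rfl⟩

/-- The triangle. -/
def triangleGraph : SimpleGraph (Fin 3) := ⊤

/-! Graphs with more than `(2s+2)n` edges are big. One can pick disjoint edges greedily from any `s
+ 1` big graphs, so a collection without rainbow `M_{s+1}` has at most `s` of them
(`card_bigIndices_le`), and the others contribute `O(n)`. Padding with empty graphs gives the
reverse inequality, hence (i). If exactly `s` graphs are big, all others are empty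
(`eq_bot_of_card_bigIndices_eq`).

For triangles, give each pair of vertices the list of indices of the graphs containing it. If `uv`
carries at least three colours, the lists of `ux` and `vx` cannot both be nonempty unless they are
the same singleton. Deleting heavy pairs one by one bounds `s ≥ 4` graphs by `s⌊n²/4⌋`
(`weight_le`). With fewer than `s` big graphs, the `O(n)` remainder fits into the share of one
missing graph, except when `s` is 3 or 4.

Those cases need `n(n-1)` exactly for three graphs plus a remainder of `O(n)` edges
(`weight_le_of_small_rest`). Many deletions of heavy pairs save more than the remainder. After few
deletions every pair left has at most two colours, and vertices joined to a deleted vertex by long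
lists form a set spanning no colours, whose quadratic loss outweighs their linear gain. -/

/-- A symmetric assignment of colour lists to the pairs of vertices without a rainbow triangle. -/
structure RainbowTriangleFree {V ι : Type*} (col : V → V → Finset ι) : Prop where
  symm : ∀ u v, col u v = col v u
  irrefl : ∀ u, col u u = ∅
  not_rainbow : ∀ {u v w i j k}, i ∈ col u v → j ∈ col u w → k ∈ col v w →
    i ≠ j → i ≠ k → j ≠ k → False

/-! ### Colour lists on pairs and deletion of heavy pairs -/

section ColourLists

variable {V ι : Type*} {col : V → V → Finset ι}

/-- The total number of colours on the ordered pairs of vertices of `S`. -/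
def colourWeight (col : V → V → Finset ι) (S : Finset V) : ℕ :=
  ∑ u ∈ S, ∑ v ∈ S, (col u v).card

theorem RainbowTriangleFree.inter [DecidableEq ι] (h : RainbowTriangleFree col) (A : Finset ι) :
    RainbowTriangleFree (fun u v => col u v ∩ A) where
  symm u v := by rw [h.symm]
  irrefl u := by simp [h.irrefl]
  not_rainbow hi hj hk := h.not_rainbow (Finset.mem_inter.1 hi).1 (Finset.mem_inter.1 hj).1
    (Finset.mem_inter.1 hk).1

theorem RainbowTriangleFree.weight_insert [DecidableEq V] (h : RainbowTriangleFree col) {S : Finset V} {u : V}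
    (hu : u ∉ S) :
    colourWeight col (insert u S) = colourWeight col S + 2 * ∑ x ∈ S, (col u x).card := by
  unfold colourWeight
  rw [Finset.sum_insert hu]
  simp only [Finset.sum_insert hu, h.irrefl, Finset.sum_add_distrib, Finset.card_empty]
  rw [Finset.sum_congr rfl (fun x _ => by rw [h.symm x u] : ∀ x ∈ S, (col x u).card = (col u x).card)]
  ring

theorem RainbowTriangleFree.weight_insert_insert [DecidableEq V] (h : RainbowTriangleFree col) {S : Finset V}
    {u v : V} (huv : u ≠ v) (hu : u ∉ S) (hv : v ∉ S) :
    colourWeight col (insert u (insert v S)) = colourWeight col S + 2 * (col u v).card +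
      2 * ∑ x ∈ S, ((col u x).card + (col v x).card) := by
  rw [h.weight_insert (by simp [huv, hu]), h.weight_insert hv, Finset.sum_insert hv,
    Finset.sum_add_distrib]
  ring

/-- Two different colours on `ux` and `vx` would leave a third one on `uv` to close a rainbow
triangle. So every colour of one list equals every colour of the other. -/
theorem RainbowTriangleFree.of_three_le [DecidableEq ι] (h : RainbowTriangleFree col) {u v : V}
    (huv : 3 ≤ (col u v).card) (x : V) :
    col u x = ∅ ∨ col v x = ∅ ∨ ∃ c, col u x = {c} ∧ col v x = {c} := by
  rcases (col u x).eq_empty_or_nonempty with hu | ⟨i, hi⟩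
  · exact .inl hu
  rcases (col v x).eq_empty_or_nonempty with hv | ⟨j, hj⟩
  · exact .inr (.inl hv)
  have key : ∀ a ∈ col u x, ∀ b ∈ col v x, a = b := by
    intro a ha b hb
    by_contra hab
    obtain ⟨c, hc, hc'⟩ := Finset.exists_mem_notMem_of_card_lt_card
      (lt_of_le_of_lt (Finset.card_le_two (a := a) (b := b)) huv)
    simp only [Finset.mem_insert, Finset.mem_singleton, not_or] at hc'
    exact h.not_rainbow hc ha hb hc'.1 hc'.2 hab
  refine .inr (.inr ⟨i, ?_, ?_⟩)
  · ext a
    simp only [Finset.mem_singleton]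
    exact ⟨fun ha => (key a ha j hj).trans (key i hi j hj).symm, fun ha => ha ▸ hi⟩
  · ext a
    simp only [Finset.mem_singleton]
    exact ⟨fun ha => (key i hi a ha).symm, fun ha => by rw [ha, key i hi j hj]; exact hj⟩

theorem RainbowTriangleFree.card_inter_add_le [DecidableEq ι] (h : RainbowTriangleFree col) {u v : V}
    (huv : 3 ≤ (col u v).card) (x : V) {A : Finset ι} {s : ℕ} (hA : A.card ≤ s) (hs : 2 ≤ s) :
    (col u x ∩ A).card + (col v x ∩ A).card ≤ s := by
  have h1 : (col u x ∩ A).card ≤ A.card := Finset.card_le_card Finset.inter_subset_right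
  have h2 : (col v x ∩ A).card ≤ A.card := Finset.card_le_card Finset.inter_subset_right
  rcases h.of_three_le huv x with h0 | h0 | ⟨c, hc, hc'⟩
  · rw [h0, Finset.empty_inter, Finset.card_empty]; omega
  · rw [h0, Finset.empty_inter, Finset.card_empty]; omega
  · have : (({c} : Finset ι) ∩ A).card ≤ 1 :=
      (Finset.card_le_card Finset.inter_subset_left).trans (Finset.card_singleton c).le
    rw [hc, hc']; omega

/-- Only ordered pairs of `S` not inside `I` carry colours, at most two each. The saving from `I` is
what pays for long lists in `weight_le_of_small_rest`. -/
theorem RainbowTriangleFree.weight_add_le [DecidableEq V] (h : RainbowTriangleFree col) {S I : Finset V}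
    (hS : ∀ u ∈ S, ∀ v ∈ S, (col u v).card ≤ 2) (hIS : I ⊆ S)
    (hI : ∀ u ∈ I, ∀ v ∈ I, col u v = ∅) :
    colourWeight col S + 2 * (I.card * (I.card - 1)) ≤ 2 * (S.card * (S.card - 1)) := by
  have h1 : colourWeight col S = ∑ p ∈ S.offDiag \ I.offDiag, (col p.1 p.2).card := by
    unfold colourWeight
    rw [← Finset.sum_product']
    symm
    apply Finset.sum_subset
    · exact fun p hp => by
        simp only [Finset.mem_sdiff, Finset.mem_offDiag] at hp
        exact Finset.mem_product.2 ⟨hp.1.1, hp.1.2.1⟩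
    · rintro ⟨a, b⟩ hp hp'
      simp only [Finset.mem_product, Finset.mem_sdiff, Finset.mem_offDiag] at hp hp'
      by_cases hab : a = b
      · simp [hab, h.irrefl]
      · have : a ∈ I ∧ b ∈ I := by tauto
        simp [hI a this.1 b this.2]
  have h2 : ∑ p ∈ S.offDiag \ I.offDiag, (col p.1 p.2).card ≤ (S.offDiag \ I.offDiag).card * 2 := by
    rw [← smul_eq_mul]
    apply Finset.sum_le_card_nsmul
    intro p hp
    simp only [Finset.mem_sdiff, Finset.mem_offDiag] at hp
    exact hS _ hp.1.1 _ hp.1.2.1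
  have h3 := Finset.card_sdiff_add_card_eq_card (Finset.offDiag_mono hIS)
  rw [Finset.offDiag_card, Finset.offDiag_card] at h3
  rw [Nat.mul_sub_one, Nat.mul_sub_one]
  omega

theorem exists_eq_insert_insert [DecidableEq V] {S : Finset V} {u v : V} (hu : u ∈ S) (hv : v ∈ S) (huv : u ≠ v) :
    ∃ S', S = insert u (insert v S') ∧ u ∉ S' ∧ v ∉ S' ∧ S'.card + 2 = S.card ∧ S' ⊆ S := by
  have h1 : S = insert u (insert v ((S.erase u).erase v)) := by
    rw [Finset.insert_erase (Finset.mem_erase.2 ⟨huv.symm, hv⟩), Finset.insert_erase hu]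
  have hu' : u ∉ (S.erase u).erase v := by simp
  have hv' : v ∉ (S.erase u).erase v := by simp
  refine ⟨_, h1, hu', hv', ?_, (Finset.erase_subset _ _).trans (Finset.erase_subset _ _)⟩
  conv_rhs => rw [h1, Finset.card_insert_of_notMem (by simp [huv]), Finset.card_insert_of_notMem hv']

theorem RainbowTriangleFree.ne_of_three_le (h : RainbowTriangleFree col) {u v : V}
    (huv : 3 ≤ (col u v).card) : u ≠ v := by
  rintro rfl
  simp [h.irrefl] at huv

/-- Induction on `S`: deleting a heavy pair loses at most `s` colours on the pair and `s` towards
each of the `m` remaining vertices, which is the recursion asked of `B`. Without heavy pairs there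
are at most two colours per pair. -/
theorem RainbowTriangleFree.weight_le [DecidableEq V] [DecidableEq ι] (h : RainbowTriangleFree col) {s : ℕ} (hs : 2 ≤ s)
    (B : ℕ → ℕ) (hB : ∀ m, m * (m - 1) ≤ B m) (hB' : ∀ m, B m + s * (m + 1) ≤ B (m + 2))
    {A : Finset ι} (hA : A.card ≤ s) (S : Finset V) :
    colourWeight (fun u v => col u v ∩ A) S ≤ 2 * B S.card := by
  have hi := h.inter A
  induction S using Finset.strongInduction with
  | H S ih =>
    by_cases hS : ∀ u ∈ S, ∀ v ∈ S, (col u v ∩ A).card ≤ 2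
    · have := hi.weight_add_le hS (Finset.empty_subset S) (by simp)
      have := hB S.card
      omega
    · push Not at hS
      obtain ⟨u, hu, v, hv, huv⟩ := hS
      have huv' : 3 ≤ (col u v).card :=
        (Nat.succ_le_of_lt huv).trans (Finset.card_le_card Finset.inter_subset_left)
      have hne := h.ne_of_three_le huv'
      obtain ⟨S', rfl, hu', hv', hc, hsub⟩ := exists_eq_insert_insert hu hv hne
      have h1 := ih S' (Finset.ssubset_iff_subset_ne.2 ⟨hsub, fun h => by rw [← h] at hc; omega⟩)
      have h2 : ∑ x ∈ S', ((col u x ∩ A).card + (col v x ∩ A).card) ≤ S'.card * s := by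
        rw [← smul_eq_mul]
        exact Finset.sum_le_card_nsmul _ _ _ fun x _ => h.card_inter_add_le huv' x hA hs
      have h3 : (col u v ∩ A).card ≤ s :=
        (Finset.card_le_card Finset.inter_subset_right).trans hA
      rw [hi.weight_insert_insert hne hu' hv', ← hc]
      have h4 := hB' S'.card
      rw [mul_add, mul_comm s] at h4
      omega

/-- Either many heavy pairs can be removed one after the other, which makes the weight in the
colours of `A` small, or few removals leave no heavy pair. -/
theorem RainbowTriangleFree.removal_dichotomy [DecidableEq V] [DecidableEq ι] (h : RainbowTriangleFree col) [Fintype ι] {p : ℕ}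
    (hp : ∀ I : Finset V, (∀ u ∈ I, ∀ v ∈ I, col u v = ∅) → I.card ≤ p)
    {A : Finset ι} (hA : A.card ≤ 3) (R : ℕ) (S : Finset V) :
    (colourWeight (fun u v => col u v ∩ A) S : ℤ) + 2 * (R * (S.card - 2 * R - 1))
        ≤ 2 * (S.card : ℤ) ^ 2 ∨
    ∃ (j : ℕ) (S' : Finset V), j ≤ R ∧ S' ⊆ S ∧ S'.card + 2 * j = S.card ∧
      (∀ u ∈ S', ∀ v ∈ S', (col u v).card ≤ 2) ∧
      colourWeight col S ≤ colourWeight col S' +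
        2 * (j * (Fintype.card ι + 3 * S.card + 2 * (Fintype.card ι * p))) := by
  induction R generalizing S with
  | zero =>
    left
    -- The sharper `m * (m - 1)` violates the recursion at `m = 0`, where one pair may carry three
    -- colours; `m ^ 2` satisfies it.
    have := h.weight_le (s := 3) (by norm_num) (fun m => m ^ 2)
      (fun m => by rw [sq]; exact Nat.mul_le_mul_left _ (Nat.sub_le _ _))
      (fun m => by ring_nf; omega) hA S
    simp only [Nat.cast_zero, zero_mul, mul_zero, add_zero]
    exact_mod_cast this
  | succ R ih =>
    by_cases hS : ∀ u ∈ S, ∀ v ∈ S, (col u v).card ≤ 2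
    · exact .inr ⟨0, S, by simp, subset_rfl, by simp, hS, by simp⟩
    push Not at hS
    obtain ⟨u, hu, v, hv, huv⟩ := hS
    replace huv : 3 ≤ (col u v).card := huv
    have hne := h.ne_of_three_le huv
    obtain ⟨S₁, rfl, hu', hv', hc, hsub⟩ := exists_eq_insert_insert hu hv hne
    rcases ih S₁ with h1 | ⟨j, S', hj, hS', hcard, hlight, hw⟩
    · left
      have h2 : ∑ x ∈ S₁, ((col u x ∩ A).card + (col v x ∩ A).card) ≤ S₁.card * 3 := by
        rw [← smul_eq_mul]
        exact Finset.sum_le_card_nsmul _ _ _ fun x _ =>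
          h.card_inter_add_le huv x hA (by norm_num)
      have h3 : (col u v ∩ A).card ≤ 3 :=
        (Finset.card_le_card Finset.inter_subset_right).trans hA
      -- With `m` vertices, the pair loses at most `3(m-1)` colours of `A` while `m²` drops by
      -- `4(m-1)`: a gain of `m-1`.
      rw [(h.inter A).weight_insert_insert hne hu' hv', ← hc]
      zify at h2 h3
      push_cast
      nlinarith
    · right
      refine ⟨j + 1, S', by omega, hS'.trans hsub, by omega, hlight, ?_⟩
      -- A colour `c` on `xy`, a colour other than `c` on `wx` and a third one on `wy` form a
      -- rainbow triangle. So the ends of long lists at `w` span no colours.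
      have hY : ∀ w, (S₁.filter fun x => 4 ≤ (col w x).card).card ≤ p := by
        intro w
        apply hp
        intro x hx y hy
        rw [Finset.mem_filter] at hx hy
        by_contra hxy
        obtain ⟨c, hc⟩ := Finset.nonempty_iff_ne_empty.2 hxy
        obtain ⟨i, hi, hi'⟩ := Finset.exists_mem_notMem_of_card_lt_card
          (s := {c}) (t := col w x) (by rw [Finset.card_singleton]; omega)
        obtain ⟨k, hk, hk'⟩ := Finset.exists_mem_notMem_of_card_lt_card
          (s := {c, i}) (t := col w y) (lt_of_le_of_lt Finset.card_le_two (by omega))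
        simp only [Finset.mem_insert, Finset.mem_singleton, not_or] at hi' hk'
        exact h.not_rainbow hi hk hc (Ne.symm hk'.2) hi' hk'.1
      have hcolcard : ∀ a b, (col a b).card ≤ Fintype.card ι := fun a b => Finset.card_le_univ _
      have hsum : ∑ x ∈ S₁, ((col u x).card + (col v x).card) ≤
          ∑ x ∈ S₁, (3 + Fintype.card ι * ((if 4 ≤ (col u x).card then 1 else 0) +
            (if 4 ≤ (col v x).card then 1 else 0))) := by
        apply Finset.sum_le_sum
        intro x _
        have h1 := hcolcard u x
        have h2 := hcolcard v x
        rcases h.of_three_le huv x with h0 | h0 | ⟨c, hc, hc'⟩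
        · rw [h0, Finset.card_empty]
          split_ifs <;> simp <;> omega
        · rw [h0, Finset.card_empty]
          split_ifs <;> simp <;> omega
        · rw [hc, hc', Finset.card_singleton]
          simp
      rw [Finset.sum_add_distrib (f := fun _ => 3), ← Finset.mul_sum,
        Finset.sum_add_distrib (f := fun x => if 4 ≤ (col u x).card then 1 else 0), ← Finset.card_filter,
        ← Finset.card_filter, Finset.sum_const, smul_eq_mul] at hsum
      have h5 := Nat.mul_le_mul_left (Fintype.card ι) (add_le_add (hY u) (hY v))
      have h6 := hcolcard u v
      rw [h.weight_insert_insert hne hu' hv', ← hc]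
      nlinarith

theorem RainbowTriangleFree.weight_le_of_small_rest [DecidableEq V] [DecidableEq ι] [Fintype V]
    [Fintype ι] (h : RainbowTriangleFree col) {A : Finset ι} (hA : A.card ≤ 3) (C : ℕ)
    (hC : colourWeight col Finset.univ ≤
      colourWeight (fun u v => col u v ∩ A) Finset.univ + 2 * (C * Fintype.card V))
    (hn : 10 * (C + 2) ^ 2 * (Fintype.card ι + 1) ^ 2 ≤ Fintype.card V) :
    colourWeight col Finset.univ ≤ 2 * (Fintype.card V * (Fintype.card V - 1)) := by
  obtain ⟨I, hI, hmax⟩ := Finset.exists_max_image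
    (Finset.univ.filter fun I : Finset V => ∀ u ∈ I, ∀ v ∈ I, col u v = ∅) Finset.card
    ⟨∅, by simp⟩
  rw [Finset.mem_filter] at hI
  have hn1 : 1 ≤ Fintype.card V := le_trans (Nat.succ_le_of_lt (by positivity)) hn
  -- Of the `C + 2` deletions, `C` pay for the colours outside `A`, one for passing from `n²` to
  -- `n(n-1)`, and one for the constant terms.
  have hdich := h.removal_dichotomy (p := I.card)
    (fun J hJ => hmax J (Finset.mem_filter.2 ⟨Finset.mem_univ _, hJ⟩)) hA (C + 2) Finset.univ
  rw [Finset.card_univ] at hdich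
  have hcast : ∀ m : ℕ, ((m * (m - 1) : ℕ) : ℤ) = m * (m - 1) := by
    rintro (_ | m) <;> simp
  generalize hV : Fintype.card V = n at *
  generalize Fintype.card ι = t at *
  zify at hn hC
  zify [hn1]
  have hR : (C + 2 : ℤ) ^ 2 ≤ (C + 2 : ℤ) ^ 2 * (t + 1) ^ 2 :=
    le_mul_of_one_le_right (by positivity) (one_le_pow₀ (by omega))
  rcases hdich with h1 | ⟨j, S', hj, hS', hcard, hlight, hw⟩
  · push_cast at h1
    nlinarith
  · have h2 := h.weight_add_le hlight (I := I ∩ S') Finset.inter_subset_right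
      fun u hu v hv => hI.2 u (Finset.mem_inter.1 hu).1 v (Finset.mem_inter.1 hv).1
    have h3 : I.card ≤ (I ∩ S').card + 2 * j := by
      have h4 : (I \ S').card ≤ (Finset.univ \ S').card :=
        Finset.card_le_card (Finset.sdiff_subset_sdiff (Finset.subset_univ _) subset_rfl)
      have h5 := Finset.card_sdiff_add_card_eq_card (Finset.subset_univ S')
      have h6 := Finset.card_sdiff_add_card_inter I S'
      rw [Finset.card_univ, hV] at h5
      omega
    generalize (I ∩ S').card = q at *
    generalize I.card = p at *
    generalize S'.card = m at *
    zify at h2 h3 hw hcard hj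
    rw [← Nat.cast_mul, ← Nat.cast_mul, hcast, hcast] at h2
    have hqq : (0 : ℤ) ≤ q * (q - 1) := by
      rw [← hcast]; positivity
    obtain rfl | hj1 : j = 0 ∨ 1 ≤ j := by omega
    · simp only [Nat.cast_zero, mul_zero, add_zero, zero_mul] at hcard hw
      rw [hcard] at h2
      linarith
    · have hm : (m : ℤ) = n - 2 * j := by linarith
      rw [hm] at h2
      have hj1' : (1 : ℤ) ≤ j := by exact_mod_cast hj1
      have ht : (0 : ℤ) ≤ t := by positivity
      have hp : (j * t : ℤ) * p ≤ (j * t) * (q + 2 * j) :=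
        mul_le_mul_of_nonneg_left h3 (by positivity)
      -- The gain from long lists is linear in `q` and the loss inside `I ∩ S'` quadratic, so their
      -- difference is bounded independently of `n`.
      have hq : (2 * (j * t) + 1 : ℤ) * q - q ^ 2 ≤ (2 * (j * t) + 1) ^ 2 := by
        nlinarith [sq_nonneg ((q : ℤ) - (2 * (j * t) + 1)),
          mul_nonneg (by positivity : (0 : ℤ) ≤ 2 * (j * t) + 1) (by positivity : (0 : ℤ) ≤ (q : ℤ))]
      -- Deleting `j` pairs lowers `n(n-1)` by about `4jn` and costs about `3jn`; the spare `jn`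
      -- absorbs all remaining terms.
      have hbig : (j : ℤ) * (4 * j + 2 + t + 4 * (j * t) + j * (2 * t + 1) ^ 2) ≤ j * n := by
        apply mul_le_mul_of_nonneg_left _ (by positivity)
        have h7 : (4 * j + 2 + t + 4 * (j * t) + j * (2 * t + 1) ^ 2 : ℤ) ≤ j * (10 * (t + 1) ^ 2) := by
          nlinarith [mul_nonneg (sub_nonneg.2 hj1') ht, sq_nonneg (t : ℤ),
            mul_nonneg (sub_nonneg.2 hj1') (sq_nonneg (t : ℤ))]
        have h8 : (j : ℤ) * (10 * (t + 1) ^ 2) ≤ (C + 2 : ℤ) ^ 2 * (10 * (t + 1) ^ 2) := by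
          apply mul_le_mul_of_nonneg_right _ (by positivity)
          nlinarith
        linarith
      have hsq : (2 * (j * t) + 1 : ℤ) ^ 2 ≤ j ^ 2 * (2 * t + 1) ^ 2 := by
        rw [← mul_pow]
        apply pow_le_pow_left₀ (by positivity)
        nlinarith
      linarith

end ColourLists

/-! ### Rainbow copies -/

theorem hasRainbowCopy_triangleGraph_of_adj {n t : ℕ} {G : Fin t → SimpleGraph (Fin n)}
    {u v w : Fin n} {i j k : Fin t} (hij : i ≠ j) (hik : i ≠ k) (hjk : j ≠ k)
    (huv : (G i).Adj u v) (huw : (G j).Adj u w) (hvw : (G k).Adj v w) :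
    HasRainbowCopy triangleGraph G := by
  classical
  have hφ : Function.Injective ![u, v, w] := by
    intro a b hab
    fin_cases a <;> fin_cases b <;>
      simp_all [huv.ne, huw.ne, hvw.ne, huv.ne.symm, huw.ne.symm, hvw.ne.symm]
  have hedge : ∀ e : triangleGraph.edgeSet,
      (e : Sym2 (Fin 3)) = s(0, 1) ∨ (e : Sym2 (Fin 3)) = s(0, 2) ∨ (e : Sym2 (Fin 3)) = s(1, 2) := by
    rintro ⟨e, he⟩
    induction e using Sym2.ind with
    | h a b =>
      have hab : a ≠ b := he
      revert hab
      simp only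
      clear he
      revert a b
      decide
  refine ⟨⟨![u, v, w], hφ⟩,
    fun e => if (e : Sym2 (Fin 3)) = s(0, 1) then i else if (e : Sym2 (Fin 3)) = s(0, 2) then j else k,
    ?_, ?_⟩
  · intro e f hef
    apply Subtype.ext
    rcases hedge e with he | he | he <;> rcases hedge f with hf | hf | hf <;>
      simp_all [Ne.symm hij, Ne.symm hik, Ne.symm hjk]
  · intro e
    rcases hedge e with he | he | he <;> simp [he, huv, huw, hvw]

theorem HasRainbowCopy.exists_triangle {n t : ℕ} {G : Fin t → SimpleGraph (Fin n)}
    (h : HasRainbowCopy triangleGraph G) :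
    ∃ (u v w : Fin n) (i j k : Fin t), i ≠ j ∧ i ≠ k ∧ j ≠ k ∧
      (G i).Adj u v ∧ (G j).Adj u w ∧ (G k).Adj v w := by
  obtain ⟨φ, c, hc, h⟩ := h
  have h01 : s(0, 1) ∈ triangleGraph.edgeSet := by simp [triangleGraph]
  have h02 : s(0, 2) ∈ triangleGraph.edgeSet := by simp [triangleGraph]
  have h12 : s(1, 2) ∈ triangleGraph.edgeSet := by simp [triangleGraph]
  refine ⟨φ 0, φ 1, φ 2, c ⟨_, h01⟩, c ⟨_, h02⟩, c ⟨_, h12⟩, ?_, ?_, ?_, ?_, ?_, ?_⟩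
  · exact fun e => by simpa using hc e
  · exact fun e => by simpa using hc e
  · exact fun e => by simpa using hc e
  · exact h ⟨_, h01⟩
  · exact h ⟨_, h02⟩
  · exact h ⟨_, h12⟩

/-- Disjoint edges with distinct colours form a rainbow matching. -/
theorem hasRainbowCopy_matchingGraph {n t r : ℕ} {G : Fin t → SimpleGraph (Fin n)}
    (κ : Fin r → Fin t) (hκ : Function.Injective κ) (p : Fin r → Fin 2 → Fin n)
    (hp : ∀ i a j b, p i a = p j b → i = j ∧ a = b) (h : ∀ i, (G (κ i)).Adj (p i 0) (p i 1)) :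
    HasRainbowCopy (matchingGraph r) G := by
  have hdiv : ∀ x : Fin (2 * r), x.val / 2 < r := fun x => by omega
  have hmod : ∀ x : Fin (2 * r), x.val % 2 < 2 := fun x => by omega
  have hout : ∀ e : (matchingGraph r).edgeSet, ∃ (i : Fin r) (a b : Fin (2 * r)),
      (e : Sym2 (Fin (2 * r))) = s(a, b) ∧ a.val = 2 * i ∧ b.val = 2 * i + 1 := by
    rintro ⟨e, he⟩
    induction e using Sym2.ind with
    | h a b =>
      obtain ⟨hab, hd⟩ : a ≠ b ∧ a.val / 2 = b.val / 2 := he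
      have hab' : a.val ≠ b.val := fun h => hab (Fin.ext h)
      rcases Nat.lt_or_gt_of_ne hab' with h | h
      · exact ⟨⟨a.val / 2, hdiv a⟩, a, b, rfl, by simp only; omega, by simp only; omega⟩
      · exact ⟨⟨a.val / 2, hdiv a⟩, b, a, Sym2.eq_swap, by simp only; omega, by simp only; omega⟩
  choose idx a b he ha hb using hout
  refine ⟨⟨fun x => p ⟨_, hdiv x⟩ ⟨_, hmod x⟩, ?_⟩, fun e => κ (idx e), ?_, ?_⟩
  · intro x y hxy
    obtain ⟨h1, h2⟩ := hp _ _ _ _ hxy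
    simp only [Fin.mk.injEq] at h1 h2
    exact Fin.ext (by omega)
  · intro e f hef
    have hef' := congrArg Fin.val (hκ hef)
    apply Subtype.ext
    rw [he e, he f, Fin.ext (by rw [ha, ha, hef'] : (a e).val = (a f).val),
      Fin.ext (by rw [hb, hb, hef'] : (b e).val = (b f).val)]
  · intro e
    have h1 : (⟨_, hdiv (a e)⟩ : Fin r) = idx e := Fin.ext (by simp only; have := ha e; omega)
    have h2 : (⟨_, hdiv (b e)⟩ : Fin r) = idx e := Fin.ext (by simp only; have := hb e; omega)
    have h3 : (⟨_, hmod (a e)⟩ : Fin 2) = 0 := Fin.ext (by simp only [Fin.val_zero]; have := ha e; omega)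
    have h4 : (⟨_, hmod (b e)⟩ : Fin 2) = 1 := Fin.ext (by simp only [Fin.val_one]; have := hb e; omega)
    rw [he e, Sym2.map_mk]
    change (G (κ (idx e))).Adj (p ⟨_, hdiv (a e)⟩ ⟨_, hmod (a e)⟩) (p ⟨_, hdiv (b e)⟩ ⟨_, hmod (b e)⟩)
    rw [h1, h2, h3, h4]
    exact h _

/-! ### Greedy rainbow matchings and big graphs -/

theorem exists_adj_notMem_of_card_mul_lt {n : ℕ} (H : SimpleGraph (Fin n)) (X : Finset (Fin n))
    (h : X.card * n < H.edgeSet.ncard) : ∃ u v, u ∉ X ∧ v ∉ X ∧ H.Adj u v := by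
  by_contra! hno
  refine absurd h (not_lt.2 ?_)
  have hsub : H.edgeSet ⊆
      ((X ×ˢ Finset.univ).image fun q : Fin n × Fin n => s(q.1, q.2) : Finset (Sym2 (Fin n))) := by
    intro e he
    induction e using Sym2.ind with
    | h a b =>
      simp only [Finset.coe_image, Set.mem_image, Finset.mem_coe, Finset.mem_product,
        Finset.mem_univ, and_true]
      by_cases ha : a ∈ X
      · exact ⟨(a, b), ha, rfl⟩
      · by_cases hb : b ∈ X
        · exact ⟨(b, a), hb, Sym2.eq_swap⟩
        · exact absurd he (hno a b ha hb)
  calc H.edgeSet.ncard ≤ _ := Set.ncard_le_ncard hsub (Finset.finite_toSet _)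
    _ ≤ (X ×ˢ (Finset.univ : Finset (Fin n))).card := by
        rw [Set.ncard_coe_finset]; exact Finset.card_image_le
    _ = X.card * n := by simp

theorem cons_pair_injective {α : Type*} {r : ℕ} {u v : α} {p : Fin r → Fin 2 → α} (huv : u ≠ v)
    (hp : ∀ i a j b, p i a = p j b → i = j ∧ a = b) (hne : ∀ i a, p i a ≠ u ∧ p i a ≠ v)
    (i : Fin (r + 1)) (a : Fin 2) (j : Fin (r + 1)) (b : Fin 2)
    (h : (Fin.cons ![u, v] p : Fin (r + 1) → Fin 2 → α) i a =
      (Fin.cons ![u, v] p : Fin (r + 1) → Fin 2 → α) j b) : i = j ∧ a = b := by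
  have hnew : ∀ i a b, p i a ≠ ![u, v] b := by
    intro i a b
    fin_cases b
    · exact (hne i a).1
    · exact (hne i a).2
  revert h
  refine Fin.cases ?_ (fun i => ?_) i <;> refine Fin.cases ?_ (fun j => ?_) j
  · simp only [Fin.cons_zero]
    fin_cases a <;> fin_cases b <;> simp [huv, huv.symm]
  · simp only [Fin.cons_zero, Fin.cons_succ]
    exact fun h => absurd h.symm (hnew _ _ _)
  · simp only [Fin.cons_zero, Fin.cons_succ]
    exact fun h => absurd h (hnew _ _ _)
  · simp only [Fin.cons_succ, Fin.succ_inj]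
    exact hp _ _ _ _

/-- Greedy choice: at most `|X| n` edges meet `X`, and each chosen edge adds two vertices to the
forbidden set. -/
theorem exists_disjoint_edges {n t : ℕ} (G : Fin t → SimpleGraph (Fin n)) {r : ℕ}
    (κ : Fin r → Fin t) (X : Finset (Fin n))
    (h : ∀ i, (X.card + 2 * r) * n < (G (κ i)).edgeSet.ncard) :
    ∃ p : Fin r → Fin 2 → Fin n, (∀ i a j b, p i a = p j b → i = j ∧ a = b) ∧
      (∀ i a, p i a ∉ X) ∧ ∀ i, (G (κ i)).Adj (p i 0) (p i 1) := by
  induction r generalizing X with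
  | zero => exact ⟨fun i => i.elim0, fun i => i.elim0, fun i => i.elim0, fun i => i.elim0⟩
  | succ r ih =>
    obtain ⟨u, v, hu, hv, huv⟩ := exists_adj_notMem_of_card_mul_lt (G (κ 0)) X
      (lt_of_le_of_lt (Nat.mul_le_mul_right _ (Nat.le_add_right _ _)) (h 0))
    obtain ⟨p, hp, hX, hadj⟩ := ih (fun i => κ i.succ) (insert u (insert v X)) fun i =>
      lt_of_le_of_lt (Nat.mul_le_mul_right _ (by
        have := Finset.card_insert_le u (insert v X)
        have := Finset.card_insert_le v X
        omega)) (h i.succ)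
    have hX' : ∀ i a, p i a ≠ u ∧ p i a ≠ v ∧ p i a ∉ X := by simpa using hX
    refine ⟨Fin.cons ![u, v] p, ?_, ?_, ?_⟩
    · exact cons_pair_injective huv.ne hp fun i a => ⟨(hX' i a).1, (hX' i a).2.1⟩
    · intro i a
      refine Fin.cases ?_ (fun i => ?_) i
      · fin_cases a <;> simp [hu, hv]
      · simpa using (hX' i a).2.2
    · exact Fin.cases (by simpa using huv) (fun i => by simpa using hadj i)

/-- The indices of the graphs of the collection with more than `m` edges. -/
noncomputable def bigIndices {n t : ℕ} (G : Fin t → SimpleGraph (Fin n)) (m : ℕ) : Finset (Fin t) :=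
  open Classical in Finset.univ.filter fun i => m < (G i).edgeSet.ncard

theorem mem_bigIndices {n t m : ℕ} {G : Fin t → SimpleGraph (Fin n)} {i : Fin t} :
    i ∈ bigIndices G m ↔ m < (G i).edgeSet.ncard := by
  simp [bigIndices]

theorem card_bigIndices_le {n t s : ℕ} {G : Fin t → SimpleGraph (Fin n)}
    (h : ¬ HasRainbowCopy (matchingGraph (s + 1)) G) :
    (bigIndices G ((2 * s + 2) * n)).card ≤ s := by
  by_contra! hcard
  obtain ⟨B, hB, hBcard⟩ := Finset.exists_subset_card_eq (Nat.succ_le_of_lt hcard)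
  let κ := B.orderEmbOfFin hBcard
  obtain ⟨p, hp, -, hadj⟩ := exists_disjoint_edges G κ ∅ fun i => by
    have := mem_bigIndices.1 (hB (B.orderEmbOfFin_mem hBcard i))
    rwa [Finset.card_empty, zero_add]
  exact h (hasRainbowCopy_matchingGraph κ κ.injective p hp hadj)

/-- An edge `uv` of a further graph extends to a rainbow matching: the `s` big graphs have disjoint
edges avoiding `u` and `v`. The threshold is the same as for `s + 1` big graphs, as `2 + 2s =
2(s+1)`. -/
theorem eq_bot_of_card_bigIndices_eq {n t s : ℕ} {G : Fin t → SimpleGraph (Fin n)}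
    (h : ¬ HasRainbowCopy (matchingGraph (s + 1)) G)
    (hcard : (bigIndices G ((2 * s + 2) * n)).card = s) {j : Fin t}
    (hj : j ∉ bigIndices G ((2 * s + 2) * n)) : G j = ⊥ := by
  by_contra hbot
  obtain ⟨u, v, huv⟩ := SimpleGraph.ne_bot_iff_exists_adj.1 hbot
  let κ := (bigIndices G ((2 * s + 2) * n)).orderEmbOfFin hcard
  have hκ : ∀ i, κ i ∈ bigIndices G ((2 * s + 2) * n) := Finset.orderEmbOfFin_mem _ hcard
  obtain ⟨p, hp, hX, hadj⟩ := exists_disjoint_edges G κ {u, v} fun i => by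
    have := mem_bigIndices.1 (hκ i)
    rwa [Finset.card_pair huv.ne, add_comm]
  have hX' : ∀ i a, p i a ≠ u ∧ p i a ≠ v := by simpa using hX
  refine h (hasRainbowCopy_matchingGraph (Fin.cons j κ)
    (Fin.cons_injective_iff.2 ⟨?_, κ.injective⟩) (Fin.cons ![u, v] p) ?_ ?_)
  · rintro ⟨i, rfl⟩
    exact hj (hκ i)
  · exact cons_pair_injective huv.ne hp hX'
  · exact Fin.cases (by simpa using huv) (fun i => by simpa using hadj i)

/-! ### From collections of graphs to colour lists -/

/-- The list of indices of the graphs of the collection which contain the pair `u, v`. -/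
noncomputable def indexList {n t : ℕ} (G : Fin t → SimpleGraph (Fin n)) (u v : Fin n) :
    Finset (Fin t) :=
  open Classical in Finset.univ.filter fun i => (G i).Adj u v

theorem mem_indexList {n t : ℕ} {G : Fin t → SimpleGraph (Fin n)} {u v : Fin n} {i : Fin t} :
    i ∈ indexList G u v ↔ (G i).Adj u v := by
  simp [indexList]

theorem rainbowTriangleFree_indexList {n t : ℕ} {G : Fin t → SimpleGraph (Fin n)}
    (h : ¬ HasRainbowCopy triangleGraph G) : RainbowTriangleFree (indexList G) where
  symm u v := by ext i; simp only [mem_indexList, SimpleGraph.adj_comm]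
  irrefl u := by ext i; simp [mem_indexList]
  not_rainbow hi hj hk hij hik hjk := h (hasRainbowCopy_triangleGraph_of_adj hij hik hjk
    (mem_indexList.1 hi) (mem_indexList.1 hj) (mem_indexList.1 hk))

theorem colourWeight_indexList_inter {n t : ℕ} (G : Fin t → SimpleGraph (Fin n)) (A : Finset (Fin t)) :
    colourWeight (fun u v => indexList G u v ∩ A) Finset.univ =
      2 * ∑ i ∈ A, (G i).edgeSet.ncard := by
  classical
  have h1 : ∀ u v, (indexList G u v ∩ A).card = ∑ i ∈ A, if (G i).Adj u v then 1 else 0 := by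
    intro u v
    rw [← Finset.card_filter]
    congr 1
    ext i
    simp [mem_indexList, and_comm]
  have h2 : ∀ i, 2 * (G i).edgeSet.ncard = ∑ u, ∑ v, if (G i).Adj u v then 1 else 0 := by
    intro i
    rw [Set.ncard_eq_toFinset_card', ← SimpleGraph.edgeFinset, ← SimpleGraph.sum_degrees_eq_twice_card_edges]
    refine Finset.sum_congr rfl fun u _ => ?_
    rw [← SimpleGraph.card_neighborFinset_eq_degree, SimpleGraph.neighborFinset_eq_filter, Finset.card_filter]
  unfold colourWeight
  simp only [h1]
  rw [Finset.mul_sum, Finset.sum_congr rfl fun i _ => h2 i, Finset.sum_comm (s := A)]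
  exact Finset.sum_congr rfl fun u _ => Finset.sum_comm

theorem ncard_edgeSet_le_choose {n : ℕ} (H : SimpleGraph (Fin n)) :
    H.edgeSet.ncard ≤ n.choose 2 := by
  classical
  rw [Set.ncard_eq_toFinset_card', ← SimpleGraph.edgeFinset]
  simpa using H.card_edgeFinset_le_card_choose_two

theorem ncard_edgeSet_top (n : ℕ) : (⊤ : SimpleGraph (Fin n)).edgeSet.ncard = n.choose 2 := by
  classical
  rw [Set.ncard_eq_toFinset_card', ← SimpleGraph.edgeFinset]
  simpa using SimpleGraph.card_edgeFinset_top_eq_card_choose_two (V := Fin n)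

/-! ### Comparing collections of different sizes -/

theorem le_exSum {n t : ℕ} {𝓕 : GraphFamily} {G : Fin t → SimpleGraph (Fin n)}
    (h : RainbowFree 𝓕 G) : edgeSum G ≤ exSum t n 𝓕 :=
  (isGreatest_exSum ⟨_, G, h, rfl⟩).2 ⟨G, h, rfl⟩

theorem exSum_le {n t m : ℕ} {𝓕 : GraphFamily}
    (h : ∀ G : Fin t → SimpleGraph (Fin n), RainbowFree 𝓕 G → edgeSum G ≤ m) :
    exSum t n 𝓕 ≤ m := by
  rcases (edgeSums t n 𝓕).eq_empty_or_nonempty with h0 | h0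
  -- With no admissible collection the supremum is 0.
  · simp [exSum, h0]
  · obtain ⟨G, hG, hm⟩ := (isGreatest_exSum h0).1
    exact hm ▸ h G hG

theorem HasRainbowCopy.of_comp {k n s t : ℕ} {F : SimpleGraph (Fin k)}
    {G : Fin t → SimpleGraph (Fin n)} {κ : Fin s → Fin t} (hκ : Function.Injective κ)
    (h : HasRainbowCopy F (G ∘ κ)) : HasRainbowCopy F G := by
  obtain ⟨φ, c, hc, h⟩ := h
  exact ⟨φ, κ ∘ c, hκ.comp hc, h⟩

theorem sum_ncard_edgeSet_le_exSum {k n s t : ℕ} {F : SimpleGraph (Fin k)}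
    {G : Fin t → SimpleGraph (Fin n)} (h : ¬ HasRainbowCopy F G) {A : Finset (Fin t)}
    (hA : A.card = s) : ∑ i ∈ A, (G i).edgeSet.ncard ≤ exSum s n {⟨k, F⟩} := by
  have h1 : RainbowFree {⟨k, F⟩} (G ∘ A.orderEmbOfFin hA) := by
    rintro _ rfl h'
    exact h (h'.of_comp (A.orderEmbOfFin hA).injective)
  refine le_trans (le_of_eq ?_) (le_exSum h1)
  conv_lhs => rw [← Finset.map_orderEmbOfFin_univ A hA, Finset.sum_map]
  rfl

/-- Pad with empty graphs: only `s` indices carry edges, too few for a rainbow matching of `s + 1`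
edges. -/
theorem exSum_le_exSum_matching {k : ℕ} (F : SimpleGraph (Fin k)) {s t : ℕ} (hst : s ≤ t) (n : ℕ) :
    exSum s n {⟨k, F⟩} ≤ exSum t n {⟨k, F⟩, ⟨2 * (s + 1), matchingGraph (s + 1)⟩} := by
  obtain ⟨d, rfl⟩ := Nat.exists_eq_add_of_le hst
  refine exSum_le fun G hG => ?_
  let G' : Fin (s + d) → SimpleGraph (Fin n) := Fin.append G fun _ => ⊥
  have hlt : ∀ {e i}, e ∈ (G' i).edgeSet → i.val < s := by
    intro e i
    refine Fin.addCases (fun i _ => i.2) (fun i hi => ?_) i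
    simp [G'] at hi
  have hsum : edgeSum G = edgeSum G' := by
    simp [edgeSum, G', Fin.sum_univ_add]
  rw [hsum]
  apply le_exSum
  rintro _ (rfl | rfl)
  · rintro ⟨φ, c, hc, h⟩
    refine hG _ rfl ⟨φ, fun e => ⟨c e, hlt (h e)⟩, fun e f hef => hc (Fin.ext ?_), fun e => ?_⟩
    · simpa using hef
    · have h1 := h e
      have h2 : c e = Fin.castAdd d ⟨c e, hlt (h e)⟩ := rfl
      rw [h2] at h1
      simpa only [G', Fin.append_left] using h1
  · rintro ⟨φ, c, hc, h⟩
    have hedge : ∀ i : Fin (s + 1), s((⟨2 * i, by omega⟩ : Fin (2 * (s + 1))), ⟨2 * i + 1, by omega⟩) ∈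
        (matchingGraph (s + 1)).edgeSet := by
      intro i
      rw [SimpleGraph.mem_edgeSet]
      exact ⟨by simp, by simp only; omega⟩
    have hinj : Function.Injective fun i : Fin (s + 1) =>
        (⟨c ⟨_, hedge i⟩, hlt (h ⟨_, hedge i⟩)⟩ : Fin s) := by
      intro i j hij
      have h1 := hc (Fin.ext (by simpa using hij))
      simp only [Subtype.mk.injEq, Sym2.eq_iff, Fin.mk.injEq] at h1
      exact Fin.ext (by omega)
    simpa using Fintype.card_le_of_injective _ hinj

theorem sum_ncard_compl_le {n t m : ℕ} (G : Fin t → SimpleGraph (Fin n)) {A : Finset (Fin t)}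
    (hA : bigIndices G m ⊆ A) : ∑ i ∈ Aᶜ, (G i).edgeSet.ncard ≤ t * m := by
  refine (Finset.sum_le_card_nsmul _ _ m fun i hi => ?_).trans ?_
  · by_contra! h
    exact Finset.mem_compl.1 hi (hA (mem_bigIndices.2 h))
  · rw [smul_eq_mul]
    exact Nat.mul_le_mul_right _ ((Finset.card_le_univ _).trans (by simp))

theorem edgeSum_eq_add_compl {n t : ℕ} (G : Fin t → SimpleGraph (Fin n)) (A : Finset (Fin t)) :
    edgeSum G = ∑ i ∈ A, (G i).edgeSet.ncard + ∑ i ∈ Aᶜ, (G i).edgeSet.ncard :=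
  (Finset.sum_add_sum_compl A _).symm

theorem exists_superset_bigIndices {n t a m : ℕ} {G : Fin t → SimpleGraph (Fin n)}
    (h : (bigIndices G m).card ≤ a) (ha : a ≤ t) :
    ∃ A, bigIndices G m ⊆ A ∧ A.card = a := by
  obtain ⟨A, h1, -, h2⟩ := Finset.exists_subsuperset_card_eq (Finset.subset_univ (bigIndices G m)) h
    (by simpa using ha)
  exact ⟨A, h1, h2⟩

theorem exSum_matching_le {k : ℕ} (F : SimpleGraph (Fin k)) {s t : ℕ} (hst : s ≤ t) (n : ℕ) :
    exSum t n {⟨k, F⟩, ⟨2 * (s + 1), matchingGraph (s + 1)⟩} ≤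
      exSum s n {⟨k, F⟩} + t * ((2 * s + 2) * n) := by
  refine exSum_le fun G hG => ?_
  obtain ⟨A, hA, hcard⟩ := exists_superset_bigIndices
    (card_bigIndices_le (hG ⟨_, matchingGraph (s + 1)⟩ (by simp))) hst
  rw [edgeSum_eq_add_compl G A]
  exact add_le_add (sum_ncard_edgeSet_le_exSum (hG ⟨k, F⟩ (by simp)) hcard) (sum_ncard_compl_le G hA)

theorem exSum_matching_sub_isBigO {k : ℕ} (F : SimpleGraph (Fin k)) {s t : ℕ} (hst : s ≤ t) :
    (fun n : ℕ => (exSum t n {⟨k, F⟩, ⟨2 * (s + 1), matchingGraph (s + 1)⟩} : ℝ)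
      - (exSum s n {⟨k, F⟩} : ℝ)) =O[atTop] (fun n : ℕ => (n : ℝ)) := by
  refine IsBigO.of_bound ((t * (2 * s + 2) : ℕ) : ℝ) (Eventually.of_forall fun n => ?_)
  have h1 := exSum_le_exSum_matching F hst n
  have h2 := exSum_matching_le F hst n
  rw [Real.norm_of_nonneg (sub_nonneg.2 (by exact_mod_cast h1)), Real.norm_of_nonneg (by positivity),
    sub_le_iff_le_add]
  have h3 : exSum t n {⟨k, F⟩, ⟨2 * (s + 1), matchingGraph (s + 1)⟩} ≤
    t * (2 * s + 2) * n + exSum s n {⟨k, F⟩} := by linarith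
  exact_mod_cast h3

/-! ### Rainbow triangles -/

theorem mul_pred_le_four_mul_sq_div (m : ℕ) : m * (m - 1) ≤ 4 * (m ^ 2 / 4) := by
  obtain ⟨q, rfl | rfl⟩ : ∃ q, m = 2 * q ∨ m = 2 * q + 1 := ⟨m / 2, by omega⟩
  · rw [show (2 * q) ^ 2 = 4 * q ^ 2 by ring, Nat.mul_div_cancel_left _ (by norm_num)]
    exact (Nat.mul_le_mul_left _ (Nat.sub_le _ _)).trans (by nlinarith)
  · rw [show (2 * q + 1) ^ 2 = 4 * (q ^ 2 + q) + 1 by ring, Nat.mul_add_div (by norm_num),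
      Nat.add_sub_cancel]
    norm_num
    nlinarith

theorem pred_mul_add_self {s : ℕ} (hs : 1 ≤ s) (x : ℕ) : (s - 1) * x + x = s * x := by
  rw [← Nat.succ_mul, Nat.succ_eq_add_one, Nat.sub_add_cancel hs]

/-- `⌊m²/4⌋` grows by exactly `m + 1` from `m` to `m + 2`, and `a ≥ 4` makes `a⌊m²/4⌋` dominate
`m(m-1)`. -/
theorem sum_ncard_edgeSet_le_mul_sq_div {n t : ℕ} {G : Fin t → SimpleGraph (Fin n)}
    (h : ¬ HasRainbowCopy triangleGraph G) {A : Finset (Fin t)} {a : ℕ} (ha : 4 ≤ a)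
    (hA : A.card = a) : ∑ i ∈ A, (G i).edgeSet.ncard ≤ a * (n ^ 2 / 4) := by
  have h1 := (rainbowTriangleFree_indexList h).weight_le (s := a) (by omega)
    (fun m => a * (m ^ 2 / 4))
    (fun m => (mul_pred_le_four_mul_sq_div m).trans (Nat.mul_le_mul_right _ ha))
    (fun m => by
      rw [← mul_add, show (m + 2) ^ 2 = m ^ 2 + 4 * (m + 1) by ring,
        Nat.add_mul_div_left _ _ (by norm_num)])
    hA.le Finset.univ
  rw [colourWeight_indexList_inter, Finset.card_univ, Fintype.card_fin] at h1
  omega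

theorem edgeSum_le_of_three {n t C : ℕ} {G : Fin t → SimpleGraph (Fin n)}
    (h : ¬ HasRainbowCopy triangleGraph G) {A : Finset (Fin t)} (hA : A.card ≤ 3)
    (hC : ∑ i ∈ Aᶜ, (G i).edgeSet.ncard ≤ C * n) (hn : 10 * (C + 2) ^ 2 * (t + 1) ^ 2 ≤ n) :
    edgeSum G ≤ n * (n - 1) := by
  have huniv : colourWeight (indexList G) Finset.univ = 2 * edgeSum G := by
    have := colourWeight_indexList_inter G Finset.univ
    simp only [Finset.inter_univ] at this
    exact this
  have h1 := (rainbowTriangleFree_indexList h).weight_le_of_small_rest hA C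
    (by
      rw [huniv, colourWeight_indexList_inter, edgeSum_eq_add_compl G A, Fintype.card_fin]
      omega)
    (by simpa using hn)
  rw [huniv, Fintype.card_fin] at h1
  omega

/-- The largest number of edges of `s` graphs on `n` vertices without a rainbow triangle,
for large `n`. -/
def rainbowTriangleBound (s n : ℕ) : ℕ :=
  if s ≤ 2 then s * n.choose 2 else if s = 3 then n * (n - 1) else s * (n ^ 2 / 4)

theorem edgeSum_le_rainbowTriangleBound {n s t : ℕ} (hst : s + 1 ≤ t)
    (hn : 10 * (t * (2 * s + 2) + 2) ^ 2 * (t + 1) ^ 2 ≤ n) {G : Fin t → SimpleGraph (Fin n)}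
    (h : ¬ HasRainbowCopy triangleGraph G)
    (hM : ¬ HasRainbowCopy (matchingGraph (s + 1)) G) :
    edgeSum G ≤ rainbowTriangleBound s n := by
  have hbig := card_bigIndices_le hM
  have hcompl : ∀ A, bigIndices G ((2 * s + 2) * n) ⊆ A →
      ∑ i ∈ Aᶜ, (G i).edgeSet.ncard ≤ (t * (2 * s + 2)) * n := fun A hA =>
    (sum_ncard_compl_le G hA).trans_eq (mul_assoc _ _ _).symm
  have hnC : 4 * (t * (2 * s + 2)) + 1 ≤ n := by
    refine le_trans ?_ hn
    refine le_trans ?_ (Nat.le_mul_of_pos_right _ (by positivity))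
    nlinarith [Nat.zero_le (t * (2 * s + 2))]
  have hfull : (bigIndices G ((2 * s + 2) * n)).card = s →
      edgeSum G = ∑ i ∈ bigIndices G ((2 * s + 2) * n), (G i).edgeSet.ncard := by
    intro hcard
    rw [edgeSum_eq_add_compl G (bigIndices G ((2 * s + 2) * n)), Nat.add_eq_left]
    refine Finset.sum_eq_zero fun i hi => ?_
    simp [eq_bot_of_card_bigIndices_eq hM hcard (Finset.mem_compl.1 hi)]
  generalize t * (2 * s + 2) = C at *
  have hchoose : C * n ≤ n.choose 2 := by
    rw [Nat.choose_two_right, Nat.le_div_iff_mul_le (by norm_num), mul_right_comm, mul_comm]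
    exact Nat.mul_le_mul_left _ (by omega)
  have hsq : C * n ≤ n ^ 2 / 4 := by
    rw [Nat.le_div_iff_mul_le (by norm_num), sq]
    nlinarith
  unfold rainbowTriangleBound
  split_ifs with h2 h3
  · rcases hbig.eq_or_lt with hcard | hcard
    · rw [hfull hcard]
      refine (Finset.sum_le_card_nsmul _ _ _ fun i _ => ncard_edgeSet_le_choose _).trans ?_
      rw [hcard, smul_eq_mul]
    · rw [edgeSum_eq_add_compl G (bigIndices G ((2 * s + 2) * n))]
      refine (add_le_add ((Finset.sum_le_card_nsmul _ _ _ fun i _ =>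
        ncard_edgeSet_le_choose _).trans ?_) ((hcompl _ subset_rfl).trans hchoose)).trans
        (pred_mul_add_self (by omega) _).le
      rw [smul_eq_mul]
      exact Nat.mul_le_mul_right _ (by omega)
  · exact edgeSum_le_of_three h (hbig.trans h3.le) (hcompl _ subset_rfl) hn
  · rcases hbig.eq_or_lt with hcard | hcard
    · rw [hfull hcard]
      exact sum_ncard_edgeSet_le_mul_sq_div h (by omega) hcard
    -- For `s = 4` at most three graphs are big, where `a⌊n²/4⌋` is unavailable and the three-graph
    -- bound is used. Otherwise `s - 1 ≥ 4`, and the remainder is at most one further `⌊n²/4⌋`.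
    · obtain h4 | h4 : s = 4 ∨ 4 ≤ s - 1 := by omega
      · subst h4
        exact (edgeSum_le_of_three h (by omega) (hcompl _ subset_rfl) hn).trans
          (mul_pred_le_four_mul_sq_div n)
      · obtain ⟨A, hA, hAcard⟩ := exists_superset_bigIndices
          (G := G) (m := (2 * s + 2) * n) (a := s - 1) (by omega) (by omega)
        rw [edgeSum_eq_add_compl G A]
        exact (add_le_add (sum_ncard_edgeSet_le_mul_sq_div h h4 hAcard)
          ((hcompl A hA).trans hsq)).trans (pred_mul_add_self (by omega) _).le

theorem ncard_edgeSet_turanGraph_two (n : ℕ) :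
    (SimpleGraph.turanGraph n 2).edgeSet.ncard = n ^ 2 / 4 := by
  rw [Set.ncard_eq_toFinset_card', ← SimpleGraph.edgeFinset, SimpleGraph.card_edgeFinset_turanGraph]
  rcases Nat.mod_two_eq_zero_or_one n with h | h
  · rw [h]; simp
  · rw [h]
    obtain ⟨q, rfl⟩ : ∃ q, n = 2 * q + 1 := ⟨n / 2, by omega⟩
    rw [show (2 * q + 1) ^ 2 = 4 * (q ^ 2 + q) + 1 by ring]
    simp
    omega

/-- Extremal collections: complete graphs when there are fewer than three indices, two complete
graphs and an empty one for `s = 3`, and `s` copies of the balanced complete bipartite graph beyond.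
-/
theorem rainbowTriangleBound_le_exSum (s n : ℕ) :
    rainbowTriangleBound s n ≤ exSum s n {⟨3, triangleGraph⟩} := by
  unfold rainbowTriangleBound
  split_ifs with h2 h3
  · refine le_trans (le_of_eq ?_)
      (le_exSum (G := fun _ : Fin s => (⊤ : SimpleGraph (Fin n))) ?_)
    · simp only [edgeSum, ncard_edgeSet_top, Finset.sum_const, Finset.card_univ, Fintype.card_fin,
        smul_eq_mul]
    · rintro _ rfl h
      obtain ⟨-, -, -, i, j, k, hij, hik, hjk, -⟩ := h.exists_triangle
      rw [Ne, Fin.ext_iff] at hij hik hjk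
      omega
  · subst h3
    refine le_trans (le_of_eq ?_)
      (le_exSum (G := ![(⊤ : SimpleGraph (Fin n)), ⊤, ⊥]) ?_)
    · rw [edgeSum, Fin.sum_univ_three]
      change _ = (⊤ : SimpleGraph (Fin n)).edgeSet.ncard + (⊤ : SimpleGraph (Fin n)).edgeSet.ncard +
        (⊥ : SimpleGraph (Fin n)).edgeSet.ncard
      rw [ncard_edgeSet_top, SimpleGraph.edgeSet_bot, Set.ncard_empty, Nat.choose_two_right]
      have := Nat.div_mul_cancel (Nat.even_mul_pred_self n).two_dvd
      omega
    · rintro _ rfl h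
      obtain ⟨u, v, w, i, j, k, hij, hik, hjk, hi, hj, hk⟩ := h.exists_triangle
      fin_cases i <;> fin_cases j <;> fin_cases k <;> simp_all
  · refine le_trans (le_of_eq ?_)
      (le_exSum (G := fun _ : Fin s => SimpleGraph.turanGraph n 2) ?_)
    · simp only [edgeSum, ncard_edgeSet_turanGraph_two, Finset.sum_const, Finset.card_univ,
        Fintype.card_fin, smul_eq_mul]
    · rintro _ rfl h
      obtain ⟨u, v, w, i, j, k, -, -, -, hi, hj, hk⟩ := h.exists_triangle
      rw [SimpleGraph.turanGraph_adj] at hi hj hk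
      omega

theorem exSum_triangle_eq {n s t : ℕ} (hst : s + 1 ≤ t)
    (hn : 10 * (t * (2 * s + 2) + 2) ^ 2 * (t + 1) ^ 2 ≤ n) :
    exSum t n {⟨3, triangleGraph⟩, ⟨2 * (s + 1), matchingGraph (s + 1)⟩} =
      exSum s n {⟨3, triangleGraph⟩} ∧
    exSum s n {⟨3, triangleGraph⟩} = rainbowTriangleBound s n := by
  have h1 := rainbowTriangleBound_le_exSum s n
  have h2 := exSum_le_exSum_matching triangleGraph (Nat.le_of_succ_le hst) n
  have h3 : exSum t n {⟨3, triangleGraph⟩, ⟨2 * (s + 1), matchingGraph (s + 1)⟩} ≤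
      rainbowTriangleBound s n := exSum_le fun G hG => edgeSum_le_rainbowTriangleBound hst hn
    (hG ⟨3, triangleGraph⟩ (by simp)) (hG ⟨_, matchingGraph (s + 1)⟩ (by simp))
  exact ⟨by omega, by omega⟩

theorem theorem2 :
    (∀ (k : ℕ) (F : SimpleGraph (Fin k)) (s t : ℕ), max F.edgeSet.ncard (s + 1) ≤ t →
      (fun n : ℕ => (exSum t n {⟨k, F⟩, ⟨2 * (s + 1), matchingGraph (s + 1)⟩} : ℝ)
          - (exSum s n {⟨k, F⟩} : ℝ)) =O[atTop] (fun n : ℕ => (n : ℝ))) ∧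
    (∀ s t : ℕ, max 3 (s + 1) ≤ t → ∀ᶠ n : ℕ in atTop,
      exSum t n {⟨3, triangleGraph⟩, ⟨2 * (s + 1), matchingGraph (s + 1)⟩}
          = exSum s n {⟨3, triangleGraph⟩} ∧
      (s ≤ 2 → exSum s n {⟨3, triangleGraph⟩} = s * n.choose 2) ∧
      (s = 3 → exSum s n {⟨3, triangleGraph⟩} = n * (n - 1)) ∧
      (4 ≤ s → exSum s n {⟨3, triangleGraph⟩} = s * (n ^ 2 / 4))) := by
  refine ⟨fun k F s t ht => exSum_matching_sub_isBigO F
    (Nat.le_of_succ_le ((le_max_right _ _).trans ht)), fun s t ht => ?_⟩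
  filter_upwards [eventually_ge_atTop (10 * (t * (2 * s + 2) + 2) ^ 2 * (t + 1) ^ 2)] with n hn
  obtain ⟨h1, h2⟩ := exSum_triangle_eq ((le_max_right _ _).trans ht) hn
  refine ⟨h1, fun hs => ?_, fun hs => ?_, fun hs => ?_⟩ <;> rw [h2, rainbowTriangleBound]
  · rw [if_pos hs]
  · rw [if_neg (by omega), if_pos hs]
  · rw [if_neg (by omega), if_neg (by omega)]
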